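/- Let $E$ be a division ring and $D\subseteq E$ a division subring. Let $\mathfrak C=E\otimes_D E$ be the Sweedler coring, i.e. the $E$-coring with the obvious $E$-bimodule structure, comultiplication $\Delta(x\otimes y)=(x\otimes_D 1)\otimes_E(1\otimes_D y)$ and counit $\varepsilon(x\otimes y)=xy$. A coideal of $\mathfrak C$ is a sub-bimodule $J$ with $\varepsilon(J)=0$ and $\Delta(J)\subseteq\ker(\pi_J\otimes_E\pi_J)$, where $\pi_J:\mathfrak C\to\mathfrak C/J$ is the canonical projection; then $\mathfrak C/J$ is an $E$-coring with the induced structure. Let $\mathcal S$ be the set of all division rings $C$ with $D\subseteq C\subseteq E$, and $\mathcal T$ the set of all coideals of $\mathfrak C$. Then the maps $$\mathcal R:\mathcal T\to\mathcal S,\quad J\mapsto\{e\in E:\ e\,\pi_J(1\otimes_D 1)=\pi_J(1\otimes_D 1)\,e\},$$ $$\mathcal J:\mathcal S\to\mathcal T,\quad C\mapsto\ker\bigl(E\otimes_D E\to E\otimes_C E,\ x\otimes_D y\mapsto x\otimes_C y\bigr),$$ are well defined and mutually inverse bijections. Moreover, for $C,C'\in\mathcal S$, there is a unit $g\in E$ with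 $C'=gCg^{-1}$ if and only if $\mathfrak C/\mathcal J(C)$ and $\mathfrak C/\mathcal J(C')$ are isomorphic as $E$-corings. -/

import Mathlib

open MulOpposite

/-! ### Tensor products over a noncommutative ring -/

section BTensor

/-- The defining relations of `M ⊗_R N` for a right `R`-module `M` (a module over `Rᵐᵒᵖ`, the
element `m r` being `op r • m`) and a left `R`-module `N`: additivity in both variables and
`m r ⊗ n = m ⊗ r n`. -/
def BTensor.relations (R M N : Type*) [Ring R] [AddCommGroup M] [AddCommGroup N]
    [Module Rᵐᵒᵖ M] [Module R N] : AddSubgroup (FreeAbelianGroup (M × N)) :=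
  AddSubgroup.closure
    ({t | ∃ (m m' : M) (n : N), t = FreeAbelianGroup.of (m + m', n)
        - FreeAbelianGroup.of (m, n) - FreeAbelianGroup.of (m', n)} ∪
     {t | ∃ (m : M) (n n' : N), t = FreeAbelianGroup.of (m, n + n')
        - FreeAbelianGroup.of (m, n) - FreeAbelianGroup.of (m, n')} ∪
     {t | ∃ (m : M) (r : R) (n : N), t = FreeAbelianGroup.of (op r • m, n)
        - FreeAbelianGroup.of (m, r • n)})

/-- The tensor product `M ⊗_R N` (an abelian group) of a right `R`-module `M` and a left
`R`-module `N` over a not necessarily commutative ring `R`. -/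
def BTensor (R M N : Type*) [Ring R] [AddCommGroup M] [AddCommGroup N]
    [Module Rᵐᵒᵖ M] [Module R N] : Type _ :=
  FreeAbelianGroup (M × N) ⧸ BTensor.relations R M N

namespace BTensor

instance (R M N : Type*) [Ring R] [AddCommGroup M] [AddCommGroup N]
    [Module Rᵐᵒᵖ M] [Module R N] : AddCommGroup (BTensor R M N) :=
  inferInstanceAs (AddCommGroup (FreeAbelianGroup (M × N) ⧸ BTensor.relations R M N))

variable (R : Type*) {M N M' N' M'' N'' P : Type*} [Ring R]
  [AddCommGroup M] [AddCommGroup N] [Module Rᵐᵒᵖ M] [Module R N]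
  [AddCommGroup M'] [AddCommGroup N'] [Module Rᵐᵒᵖ M'] [Module R N']
  [AddCommGroup M''] [AddCommGroup N''] [Module Rᵐᵒᵖ M''] [Module R N'']
  [AddCommGroup P]

/-- The pure tensor `m ⊗ n`. -/
def tmul (m : M) (n : N) : BTensor R M N :=
  QuotientAddGroup.mk' (BTensor.relations R M N) (FreeAbelianGroup.of (m, n))

theorem add_tmul (m m' : M) (n : N) : tmul R (m + m') n = tmul R m n + tmul R m' n := by
  rw [← sub_eq_zero, ← sub_sub]
  simp only [tmul]
  exact (QuotientAddGroup.eq_zero_iff _).2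
    (AddSubgroup.subset_closure (Or.inl (Or.inl ⟨m, m', n, rfl⟩)))

theorem tmul_add (m : M) (n n' : N) : tmul R m (n + n') = tmul R m n + tmul R m n' := by
  rw [← sub_eq_zero, ← sub_sub]
  simp only [tmul]
  exact (QuotientAddGroup.eq_zero_iff _).2
    (AddSubgroup.subset_closure (Or.inl (Or.inr ⟨m, n, n', rfl⟩)))

theorem smul_tmul (m : M) (r : R) (n : N) : tmul R (op r • m) n = tmul R m (r • n) := by
  rw [← sub_eq_zero]
  simp only [tmul]
  exact (QuotientAddGroup.eq_zero_iff _).2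
    (AddSubgroup.subset_closure (Or.inr ⟨m, r, n, rfl⟩))

/-- The universal property: an `R`-balanced biadditive map factors through `M ⊗_R N`. -/
def lift (f : M → N → P) (hl : ∀ m m' n, f (m + m') n = f m n + f m' n)
    (hr : ∀ m n n', f m (n + n') = f m n + f m n')
    (hb : ∀ m (r : R) n, f (op r • m) n = f m (r • n)) : BTensor R M N →+ P :=
  QuotientAddGroup.lift (BTensor.relations R M N)
    (FreeAbelianGroup.lift fun p : M × N => f p.1 p.2) (by
      rw [BTensor.relations, AddSubgroup.closure_le]
      rintro t ((⟨m, m', n, rfl⟩ | ⟨m, n, n', rfl⟩) | ⟨m, r, n, rfl⟩)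
      · simp [hl]
      · simp [hr]
      · simp [hb])

@[simp]
theorem lift_tmul (f : M → N → P) (hl hr) (hb : ∀ m (r : R) n, f (op r • m) n = f m (r • n))
    (m : M) (n : N) : lift R f hl hr hb (tmul R m n) = f m n :=
  FreeAbelianGroup.lift_apply_of (fun p : M × N => f p.1 p.2) (m, n)

theorem hom_ext {f g : BTensor R M N →+ P} (h : ∀ m n, f (tmul R m n) = g (tmul R m n)) :
    f = g := by
  apply QuotientAddGroup.addMonoidHom_ext
  apply FreeAbelianGroup.lift_ext
  rintro ⟨m, n⟩
  exact h m n

/-- The map `f ⊗ g : M ⊗_R N → M' ⊗_R N'` for right, respectively left, linear `f` and `g`. -/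
def map (f : M →ₗ[Rᵐᵒᵖ] M') (g : N →ₗ[R] N') : BTensor R M N →+ BTensor R M' N' :=
  lift R (fun m n => tmul R (f m) (g n)) (by simp [add_tmul]) (by simp [tmul_add])
    (by simp [smul_tmul])

@[simp]
theorem map_tmul (f : M →ₗ[Rᵐᵒᵖ] M') (g : N →ₗ[R] N') (m : M) (n : N) :
    map R f g (tmul R m n) = tmul R (f m) (g n) :=
  lift_tmul R _ _ _ _ m n

theorem map_map (f : M →ₗ[Rᵐᵒᵖ] M') (g : N →ₗ[R] N') (f' : M' →ₗ[Rᵐᵒᵖ] M'')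
    (g' : N' →ₗ[R] N'') (t : BTensor R M N) :
    map R f' g' (map R f g t) = map R (f' ∘ₗ f) (g' ∘ₗ g) t :=
  DFunLike.congr_fun (hom_ext R (f := (map R f' g').comp (map R f g))
    (by intros; simp)) t

variable {A B : Type*} [Ring A] [Ring B]

/-- Left multiplication by `a` on an `(A, R)`-bimodule, as a right `R`-linear map. -/
def lmulHom [Module A M] [SMulCommClass A Rᵐᵒᵖ M] (a : A) : M →ₗ[Rᵐᵒᵖ] M where
  toFun m := a • m
  map_add' := smul_add a
  map_smul' r m := smul_comm a r m

/-- Right multiplication by `b` on an `(R, B)`-bimodule, as a left `R`-linear map. -/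
def rmulHom [Module Bᵐᵒᵖ N] [SMulCommClass R Bᵐᵒᵖ N] (b : Bᵐᵒᵖ) : N →ₗ[R] N where
  toFun n := b • n
  map_add' := smul_add b
  map_smul' r n := (smul_comm r b n).symm

/-- If `M` is an `(A, R)`-bimodule, then `M ⊗_R N` is a left `A`-module by
`a (m ⊗ n) = a m ⊗ n`. -/
instance leftModule [Module A M] [SMulCommClass A Rᵐᵒᵖ M] : Module A (BTensor R M N) where
  smul a t := map R (lmulHom R a) LinearMap.id t
  one_smul t := DFunLike.congr_fun (hom_ext R (f := map R (lmulHom R (1 : A)) LinearMap.id)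
    (g := AddMonoidHom.id _) (by intros; simp [lmulHom])) t
  mul_smul a a' t := DFunLike.congr_fun (hom_ext R
    (f := map R (lmulHom R (a * a')) LinearMap.id)
    (g := (map R (lmulHom R a) LinearMap.id).comp (map R (lmulHom R a') LinearMap.id))
    (by intros; simp [lmulHom, mul_smul])) t
  smul_zero a := map_zero (map R (lmulHom R a) LinearMap.id)
  smul_add a := map_add (map R (lmulHom R a) LinearMap.id)
  add_smul a a' t := DFunLike.congr_fun (hom_ext R
    (f := map R (lmulHom R (a + a')) LinearMap.id)
    (g := map R (lmulHom R a) LinearMap.id + map R (lmulHom R a') LinearMap.id)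
    (by intros; simp [lmulHom, add_smul, add_tmul])) t
  zero_smul t := DFunLike.congr_fun (hom_ext R (f := map R (lmulHom R (0 : A)) LinearMap.id)
    (g := 0) (by
      intro m n
      have h := add_tmul R (0 : M) 0 n
      simp only [add_zero, left_eq_add] at h
      simp [lmulHom, h])) t

/-- If `N` is an `(R, B)`-bimodule, then `M ⊗_R N` is a right `B`-module by
`(m ⊗ n) b = m ⊗ n b`. -/
instance rightModule [Module Bᵐᵒᵖ N] [SMulCommClass R Bᵐᵒᵖ N] :
    Module Bᵐᵒᵖ (BTensor R M N) where
  smul b t := map R LinearMap.id (rmulHom R b) t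
  one_smul t := DFunLike.congr_fun (hom_ext R
    (f := map R LinearMap.id (rmulHom R (1 : Bᵐᵒᵖ)))
    (g := AddMonoidHom.id _) (by intros; simp [rmulHom])) t
  mul_smul a a' t := DFunLike.congr_fun (hom_ext R
    (f := map R LinearMap.id (rmulHom R (a * a')))
    (g := (map R LinearMap.id (rmulHom R a)).comp (map R LinearMap.id (rmulHom R a')))
    (by intros; simp [rmulHom, mul_smul])) t
  smul_zero a := map_zero (map R LinearMap.id (rmulHom R a))
  smul_add a := map_add (map R LinearMap.id (rmulHom R a))
  add_smul a a' t := DFunLike.congr_fun (hom_ext R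
    (f := map R LinearMap.id (rmulHom R (a + a')))
    (g := map R LinearMap.id (rmulHom R a) + map R LinearMap.id (rmulHom R a'))
    (by intros; simp [rmulHom, add_smul, tmul_add])) t
  zero_smul t := DFunLike.congr_fun (hom_ext R
    (f := map R LinearMap.id (rmulHom R (0 : Bᵐᵒᵖ))) (g := 0) (by
      intro m n
      have h := tmul_add R m (0 : N) 0
      simp only [add_zero, left_eq_add] at h
      simp [rmulHom, h])) t

@[simp]
theorem lsmul_tmul [Module A M] [SMulCommClass A Rᵐᵒᵖ M] (a : A) (m : M) (n : N) :
    a • tmul R m n = tmul R (a • m) n :=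
  map_tmul R (lmulHom R a) LinearMap.id m n

@[simp]
theorem rsmul_tmul [Module Bᵐᵒᵖ N] [SMulCommClass R Bᵐᵒᵖ N] (b : Bᵐᵒᵖ) (m : M) (n : N) :
    b • tmul R m n = tmul R m (b • n) :=
  map_tmul R LinearMap.id (rmulHom R b) m n

instance [Module A M] [SMulCommClass A Rᵐᵒᵖ M] [Module Bᵐᵒᵖ N] [SMulCommClass R Bᵐᵒᵖ N] :
    SMulCommClass A Bᵐᵒᵖ (BTensor R M N) where
  smul_comm a b t := DFunLike.congr_fun (hom_ext R
    (f := (DistribSMul.toAddMonoidHom _ a).comp (DistribSMul.toAddMonoidHom _ b))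
    (g := (DistribSMul.toAddMonoidHom _ b).comp (DistribSMul.toAddMonoidHom _ a))
    (by intros; simp)) t

/-- Two additive maps on `(L ⊗_R Q) ⊗_S N` that agree on pure tensors are equal. -/
theorem hom_ext₃ {S L Q : Type*} [Ring S] [AddCommGroup L] [Module Rᵐᵒᵖ L] [AddCommGroup Q]
    [Module R Q] [Module Sᵐᵒᵖ Q] [SMulCommClass R Sᵐᵒᵖ Q] {N : Type*} [AddCommGroup N]
    [Module S N] {f g : BTensor S (BTensor R L Q) N →+ P}
    (h : ∀ l q n, f (tmul S (tmul R l q) n) = g (tmul S (tmul R l q) n)) : f = g := by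
  refine hom_ext S fun t n => ?_
  exact DFunLike.congr_fun (hom_ext R
    (f := f.comp (AddMonoidHom.mk' (fun t => tmul S t n) fun t t' => add_tmul S t t' n))
    (g := g.comp (AddMonoidHom.mk' (fun t => tmul S t n) fun t t' => add_tmul S t t' n))
    fun l q => h l q n) t

/-- For fixed `n`, the map `l ⊗ q ↦ l ⊗ (q ⊗ n)`. -/
def assocAux {S : Type*} (L Q : Type*) [Ring S] [AddCommGroup L] [Module Rᵐᵒᵖ L]
    [AddCommGroup Q] [Module R Q] [Module Sᵐᵒᵖ Q] [SMulCommClass R Sᵐᵒᵖ Q] {N : Type*}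
    [AddCommGroup N] [Module S N] (n : N) : BTensor R L Q →+ BTensor R L (BTensor S Q N) :=
  lift R (fun l q => tmul R l (tmul S q n)) (by simp [add_tmul])
    (by simp [add_tmul, tmul_add]) (fun l r q => by rw [smul_tmul, lsmul_tmul])

@[simp]
theorem assocAux_tmul {S L Q : Type*} [Ring S] [AddCommGroup L] [Module Rᵐᵒᵖ L]
    [AddCommGroup Q] [Module R Q] [Module Sᵐᵒᵖ Q] [SMulCommClass R Sᵐᵒᵖ Q] {N : Type*}
    [AddCommGroup N] [Module S N] (l : L) (q : Q) (n : N) :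
    assocAux R L Q n (tmul R l q) = tmul R l (tmul S q n) :=
  lift_tmul R _ _ _ _ l q

/-- The canonical map `(L ⊗_R Q) ⊗_S N → L ⊗_R (Q ⊗_S N)`,
`(l ⊗ q) ⊗ n ↦ l ⊗ (q ⊗ n)`. -/
def assoc {S L Q : Type*} [Ring S] [AddCommGroup L] [Module Rᵐᵒᵖ L] [AddCommGroup Q]
    [Module R Q] [Module Sᵐᵒᵖ Q] [SMulCommClass R Sᵐᵒᵖ Q] {N : Type*} [AddCommGroup N]
    [Module S N] : BTensor S (BTensor R L Q) N →+ BTensor R L (BTensor S Q N) :=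
  lift S (fun t n => assocAux R L Q n t) (fun t t' n => map_add _ t t')
    (fun t n n' => DFunLike.congr_fun (hom_ext R (f := assocAux R L Q (n + n'))
      (g := assocAux R L Q n + assocAux R L Q n') (by intros; simp [tmul_add])) t)
    (fun t s n => DFunLike.congr_fun (hom_ext R
      (f := (assocAux R L Q n).comp (DistribSMul.toAddMonoidHom (BTensor R L Q) (op s)))
      (g := assocAux R L Q (s • n)) (by intros; simp [smul_tmul])) t)

@[simp]
theorem assoc_tmul {S L Q : Type*} [Ring S] [AddCommGroup L] [Module Rᵐᵒᵖ L]
    [AddCommGroup Q] [Module R Q] [Module Sᵐᵒᵖ Q] [SMulCommClass R Sᵐᵒᵖ Q] {N : Type*}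
    [AddCommGroup N] [Module S N] (l : L) (q : Q) (n : N) :
    assoc R (tmul S (tmul R l q) n) = tmul R l (tmul S q n) :=
  (lift_tmul S _ _ _ _ (tmul R l q) n).trans (assocAux_tmul R l q n)

/-- The canonical map `R ⊗_R N → N`, `r ⊗ n ↦ r n`. -/
def lid : BTensor R R N →+ N :=
  lift R (fun r n => r • n) (fun _ _ _ => add_smul _ _ _) (fun _ _ _ => smul_add _ _ _)
    (fun r s n => by simp [mul_smul])

/-- The canonical map `M ⊗_R R → M`, `m ⊗ r ↦ m r`. -/
def rid : BTensor R M R →+ M :=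
  lift R (fun m r => op r • m) (fun _ _ _ => smul_add _ _ _)
    (fun _ _ _ => by simp [add_smul]) (fun r s n => by simp [mul_smul])

@[simp]
theorem lid_tmul (r : R) (n : N) : lid R (tmul R r n) = r • n :=
  lift_tmul R _ _ _ _ _ _

@[simp]
theorem rid_tmul (m : M) (r : R) : rid R (tmul R m r) = op r • m :=
  lift_tmul R _ _ _ _ _ _

end BTensor

end BTensor

/-! ### Bimodule maps, corings, coideals and quotient corings -/

/-- A map of `A`-bimodules. -/
structure BimodHom (A M N : Type*) [Ring A] [AddCommGroup M] [Module A M] [Module Aᵐᵒᵖ M]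
    [AddCommGroup N] [Module A N] [Module Aᵐᵒᵖ N] extends M →ₗ[A] N where
  map_op_smul' : ∀ (a : A) (m : M), toFun (op a • m) = op a • toFun m

namespace BimodHom

variable {A M N : Type*} [Ring A] [AddCommGroup M] [Module A M] [Module Aᵐᵒᵖ M]
    [AddCommGroup N] [Module A N] [Module Aᵐᵒᵖ N]

instance : CoeFun (BimodHom A M N) fun _ => M → N := ⟨fun f => f.toLinearMap⟩

/-- The underlying left linear map. -/
def left (f : BimodHom A M N) : M →ₗ[A] N := f.toLinearMap

/-- The underlying right linear map. -/
def right (f : BimodHom A M N) : M →ₗ[Aᵐᵒᵖ] N where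
  toFun m := f m
  map_add' := f.map_add'
  map_smul' a m := f.map_op_smul' a.unop m

@[simp] theorem left_apply (f : BimodHom A M N) (m : M) : f.left m = f m := rfl

@[simp] theorem right_apply (f : BimodHom A M N) (m : M) : f.right m = f m := rfl

@[simp] theorem toLinearMap_op_smul (f : BimodHom A M N) (a : Aᵐᵒᵖ) (m : M) :
    f.toLinearMap (a • m) = a • f.toLinearMap m := f.map_op_smul' a.unop m

/-- The map `f ⊗ f : M ⊗_A M → N ⊗_A N`. -/
def tensorSq (f : BimodHom A M N) : BTensor A M M →+ BTensor A N N :=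
  BTensor.map A f.right f.left

end BimodHom

/-- An `A`-coring structure on an `A`-bimodule `C`: a coassociative counital coalgebra in the
monoidal category of `A`-bimodules. -/
class Coring (A C : Type*) [Ring A] [AddCommGroup C] [Module A C] [Module Aᵐᵒᵖ C]
    [SMulCommClass A Aᵐᵒᵖ C] where
  /-- The comultiplication `Δ : C → C ⊗_A C`. -/
  comul : BimodHom A C (BTensor A C C)
  /-- The counit `ε : C → A`. -/
  counit : BimodHom A C A
  /-- `(Δ ⊗ id) Δ = (id ⊗ Δ) Δ`. -/
  coassoc : ∀ c, BTensor.assoc A (BTensor.map A comul.right LinearMap.id (comul c)) =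
    BTensor.map A LinearMap.id comul.left (comul c)
  /-- `(ε ⊗ id) Δ = id`. -/
  counit_left : ∀ c, BTensor.lid A (BTensor.map A counit.right LinearMap.id (comul c)) = c
  /-- `(id ⊗ ε) Δ = id`. -/
  counit_right : ∀ c, BTensor.rid A (BTensor.map A LinearMap.id counit.left (comul c)) = c

/-- A homomorphism of `A`-corings. -/
structure CoringHom (A C C' : Type*) [Ring A]
    [AddCommGroup C] [Module A C] [Module Aᵐᵒᵖ C] [SMulCommClass A Aᵐᵒᵖ C] [Coring A C]
    [AddCommGroup C'] [Module A C'] [Module Aᵐᵒᵖ C'] [SMulCommClass A Aᵐᵒᵖ C'] [Coring A C']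
    extends BimodHom A C C' where
  map_comul : ∀ c, Coring.comul (A := A) (toBimodHom c) =
    toBimodHom.tensorSq (Coring.comul (A := A) c)
  map_counit : ∀ c, Coring.counit (A := A) (toBimodHom c) = Coring.counit (A := A) c

/-- Two `A`-corings are isomorphic if there is a bijective coring homomorphism between them. -/
def CoringsIsomorphic (A C C' : Type*) [Ring A]
    [AddCommGroup C] [Module A C] [Module Aᵐᵒᵖ C] [SMulCommClass A Aᵐᵒᵖ C] [Coring A C]
    [AddCommGroup C'] [Module A C'] [Module Aᵐᵒᵖ C'] [SMulCommClass A Aᵐᵒᵖ C']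
    [Coring A C'] : Prop :=
  ∃ f : CoringHom A C C', Function.Bijective f.toBimodHom

/-- A sub-bimodule of an `A`-bimodule. -/
structure SubBimodule (A C : Type*) [Ring A] [AddCommGroup C] [Module A C] [Module Aᵐᵒᵖ C]
    extends AddSubgroup C where
  smul_mem' : ∀ (a : A) {x : C}, x ∈ carrier → a • x ∈ carrier
  op_smul_mem' : ∀ (a : A) {x : C}, x ∈ carrier → op a • x ∈ carrier

namespace SubBimodule

variable {A C : Type*} [Ring A] [AddCommGroup C] [Module A C] [Module Aᵐᵒᵖ C]

/-- The quotient bimodule `C / J`. -/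
def Quot (J : SubBimodule A C) : Type _ := C ⧸ J.toAddSubgroup

instance (J : SubBimodule A C) : AddCommGroup J.Quot :=
  inferInstanceAs (AddCommGroup (C ⧸ J.toAddSubgroup))

/-- The projection `C → C / J` as an additive map. -/
def mkHom (J : SubBimodule A C) : C →+ J.Quot := QuotientAddGroup.mk' J.toAddSubgroup

theorem mkHom_surjective (J : SubBimodule A C) : Function.Surjective J.mkHom :=
  QuotientAddGroup.mk'_surjective _

theorem mkHom_eq_zero (J : SubBimodule A C) {x : C} : J.mkHom x = 0 ↔ x ∈ J.toAddSubgroup :=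
  QuotientAddGroup.eq_zero_iff x

instance (J : SubBimodule A C) : Module A J.Quot where
  smul a := QuotientAddGroup.map J.toAddSubgroup J.toAddSubgroup
    (DistribSMul.toAddMonoidHom C a) (fun _ hx => J.smul_mem' a hx)
  one_smul := J.mkHom_surjective.forall.2 fun x => congrArg J.mkHom (one_smul A x)
  mul_smul a b := J.mkHom_surjective.forall.2 fun x => congrArg J.mkHom (mul_smul a b x)
  smul_zero a := congrArg J.mkHom (smul_zero a)
  smul_add a := J.mkHom_surjective.forall₂.2 fun x y => congrArg J.mkHom (smul_add a x y)
  add_smul a b := J.mkHom_surjective.forall.2 fun x => congrArg J.mkHom (add_smul a b x)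
  zero_smul := J.mkHom_surjective.forall.2 fun x => congrArg J.mkHom (zero_smul A x)

instance (J : SubBimodule A C) : Module Aᵐᵒᵖ J.Quot where
  smul a := QuotientAddGroup.map J.toAddSubgroup J.toAddSubgroup
    (DistribSMul.toAddMonoidHom C a) (fun _ hx => J.op_smul_mem' a.unop hx)
  one_smul := J.mkHom_surjective.forall.2 fun x => congrArg J.mkHom (one_smul Aᵐᵒᵖ x)
  mul_smul a b := J.mkHom_surjective.forall.2 fun x => congrArg J.mkHom (mul_smul a b x)
  smul_zero a := congrArg J.mkHom (smul_zero a)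
  smul_add a := J.mkHom_surjective.forall₂.2 fun x y => congrArg J.mkHom (smul_add a x y)
  add_smul a b := J.mkHom_surjective.forall.2 fun x => congrArg J.mkHom (add_smul a b x)
  zero_smul := J.mkHom_surjective.forall.2 fun x => congrArg J.mkHom (zero_smul Aᵐᵒᵖ x)

instance [SMulCommClass A Aᵐᵒᵖ C] (J : SubBimodule A C) : SMulCommClass A Aᵐᵒᵖ J.Quot where
  smul_comm a b := J.mkHom_surjective.forall.2 fun x => congrArg J.mkHom (smul_comm a b x)

/-- The canonical projection `π_J : C → C / J`. -/
def proj (J : SubBimodule A C) : BimodHom A C J.Quot where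
  toFun := J.mkHom
  map_add' := J.mkHom.map_add
  map_smul' _ _ := rfl
  map_op_smul' _ _ := rfl

theorem proj_surjective (J : SubBimodule A C) : Function.Surjective J.proj :=
  J.mkHom_surjective

/-- A bimodule map that vanishes on `J` descends to `C / J`. -/
def liftQuot {P : Type*} [AddCommGroup P] [Module A P] [Module Aᵐᵒᵖ P] (J : SubBimodule A C)
    (f : BimodHom A C P) (hf : ∀ x ∈ J.toAddSubgroup, f x = 0) : BimodHom A J.Quot P where
  toFun := QuotientAddGroup.lift J.toAddSubgroup f.toLinearMap.toAddMonoidHom hf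
  map_add' := map_add (QuotientAddGroup.lift J.toAddSubgroup f.toLinearMap.toAddMonoidHom hf)
  map_smul' a := J.mkHom_surjective.forall.2 fun x => f.toLinearMap.map_smul a x
  map_op_smul' a := J.mkHom_surjective.forall.2 fun x => f.map_op_smul' a x

@[simp]
theorem liftQuot_proj {P : Type*} [AddCommGroup P] [Module A P] [Module Aᵐᵒᵖ P]
    (J : SubBimodule A C) (f : BimodHom A C P) (hf : ∀ x ∈ J.toAddSubgroup, f x = 0) (x : C) :
    J.liftQuot f hf (J.proj x) = f x := rfl

end SubBimodule

/-- A coideal of an `A`-coring `C`: a sub-bimodule `J` with `ε(J) = 0` and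
`Δ(J) ⊆ ker (π_J ⊗ π_J : C ⊗_A C → C/J ⊗_A C/J)`. -/
structure Coideal (A C : Type*) [Ring A] [AddCommGroup C] [Module A C] [Module Aᵐᵒᵖ C]
    [SMulCommClass A Aᵐᵒᵖ C] [Coring A C] extends SubBimodule A C where
  counit_eq_zero : ∀ x ∈ toSubBimodule.toAddSubgroup, Coring.counit (A := A) x = 0
  comul_eq_zero : ∀ x ∈ toSubBimodule.toAddSubgroup,
    toSubBimodule.proj.tensorSq (Coring.comul (A := A) x) = 0

namespace BTensor

variable {A M N : Type*} [Ring A] [AddCommGroup M] [Module A M] [Module Aᵐᵒᵖ M]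
  [SMulCommClass A Aᵐᵒᵖ M] [AddCommGroup N] [Module A N] [Module Aᵐᵒᵖ N]
  [SMulCommClass A Aᵐᵒᵖ N]

/-- `f ⊗ f` as a map of bimodules. -/
def sqHom (f : BimodHom A M N) : BimodHom A (BTensor A M M) (BTensor A N N) where
  toFun := f.tensorSq
  map_add' := map_add _
  map_smul' a t := DFunLike.congr_fun (hom_ext A
    (f := f.tensorSq.comp (DistribSMul.toAddMonoidHom _ a))
    (g := (DistribSMul.toAddMonoidHom _ a).comp f.tensorSq)
    (by intros; simp [BimodHom.tensorSq])) t
  map_op_smul' a t := DFunLike.congr_fun (hom_ext A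
    (f := f.tensorSq.comp (DistribSMul.toAddMonoidHom _ (op a)))
    (g := (DistribSMul.toAddMonoidHom _ (op a)).comp f.tensorSq)
    (by intros; simp [BimodHom.tensorSq])) t

@[simp] theorem sqHom_tmul (f : BimodHom A M N) (x y : M) :
    sqHom f (tmul A x y) = tmul A (f x) (f y) := map_tmul A _ _ _ _

end BTensor

/-- Composition of bimodule maps. -/
def BimodHom.comp {A M N P : Type*} [Ring A] [AddCommGroup M] [Module A M] [Module Aᵐᵒᵖ M]
    [AddCommGroup N] [Module A N] [Module Aᵐᵒᵖ N] [AddCommGroup P] [Module A P]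
    [Module Aᵐᵒᵖ P] (g : BimodHom A N P) (f : BimodHom A M N) : BimodHom A M P where
  toLinearMap := g.toLinearMap ∘ₗ f.toLinearMap
  map_op_smul' a m := by simp

namespace Coideal

variable {A C : Type*} [Ring A] [AddCommGroup C] [Module A C] [Module Aᵐᵒᵖ C]
    [SMulCommClass A Aᵐᵒᵖ C] [Coring A C]

/-- The comultiplication of `C / J`, induced by that of `C`. -/
def quotComul (J : Coideal A C) : BimodHom A J.Quot (BTensor A J.Quot J.Quot) :=
  J.liftQuot ((BTensor.sqHom J.proj).comp (Coring.comul (A := A))) J.comul_eq_zero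

/-- The counit of `C / J`, induced by that of `C`. -/
def quotCounit (J : Coideal A C) : BimodHom A J.Quot A :=
  J.liftQuot (Coring.counit (A := A)) J.counit_eq_zero

theorem quotComul_proj (J : Coideal A C) (c : C) : J.quotComul (J.proj c) =
    BTensor.map A J.proj.right J.proj.left (Coring.comul (A := A) c) := rfl

theorem quotCounit_proj (J : Coideal A C) (c : C) : J.quotCounit (J.proj c) =
    Coring.counit (A := A) c := rfl

/-- The quotient coring `C / J`. -/
instance (J : Coideal A C) : Coring A J.Quot where
  comul := J.quotComul
  counit := J.quotCounit
  coassoc := by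
    refine J.proj_surjective.forall.2 fun c => ?_
    have h := congrArg (BTensor.map A J.proj.right (BTensor.sqHom J.proj).left)
      (Coring.coassoc (A := A) c)
    rw [BTensor.map_map] at h
    rw [quotComul_proj, BTensor.map_map, BTensor.map_map]
    have h1 : J.quotComul.left ∘ₗ J.proj.left =
        (BTensor.sqHom J.proj).left ∘ₗ (Coring.comul (A := A) (C := C)).left := rfl
    have h2 : J.quotComul.right ∘ₗ J.proj.right =
        (BTensor.sqHom J.proj).right ∘ₗ (Coring.comul (A := A) (C := C)).right := rfl
    rw [h1, h2, LinearMap.id_comp, LinearMap.id_comp]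
    rw [LinearMap.comp_id] at h
    rw [← h]
    have key : ∀ t : BTensor A (BTensor A C C) C,
        BTensor.assoc A (BTensor.map A (BTensor.sqHom J.proj).right J.proj.left t) =
        BTensor.map A J.proj.right (BTensor.sqHom J.proj).left (BTensor.assoc A t) := by
      exact DFunLike.congr_fun (BTensor.hom_ext₃ A
        (f := (BTensor.assoc A).comp (BTensor.map A (BTensor.sqHom J.proj).right J.proj.left))
        (g := (BTensor.map A J.proj.right (BTensor.sqHom J.proj).left).comp (BTensor.assoc A))
        (by intros; simp))
    rw [← key, BTensor.map_map]
    rfl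
  counit_left := by
    refine J.proj_surjective.forall.2 fun c => ?_
    have h := congrArg J.proj (Coring.counit_left (A := A) c)
    rw [quotComul_proj, BTensor.map_map]
    rw [← h]
    exact DFunLike.congr_fun (BTensor.hom_ext A
      (f := (BTensor.lid A).comp (BTensor.map A _ _))
      (g := J.proj.toLinearMap.toAddMonoidHom.comp ((BTensor.lid A).comp (BTensor.map A _ _)))
      (by intros; simp [quotCounit_proj])) _
  counit_right := by
    refine J.proj_surjective.forall.2 fun c => ?_
    have h := congrArg J.proj (Coring.counit_right (A := A) c)
    rw [quotComul_proj, BTensor.map_map]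
    rw [← h]
    exact DFunLike.congr_fun (BTensor.hom_ext A
      (f := (BTensor.rid A).comp (BTensor.map A _ _))
      (g := J.proj.toLinearMap.toAddMonoidHom.comp ((BTensor.rid A).comp (BTensor.map A _ _)))
      (by intros; simp [quotCounit_proj])) _

/-- The projection `π_J : C → C / J` is a homomorphism of corings. -/
def projHom (J : Coideal A C) : CoringHom A C J.Quot where
  toBimodHom := J.proj
  map_comul _ := rfl
  map_counit _ := rfl

end Coideal

/-! ### The Sweedler coring of an extension of division rings -/

section Sweedler

variable {E : Type*} [DivisionRing E]

/-- `E` as a right vector space over a division subring `D`, by right multiplication. -/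
instance Subfield.rightModule (D : Subfield E) : Module (↥D)ᵐᵒᵖ E :=
  Module.compHom E (RingHom.op D.subtype)

theorem Subfield.op_smul_eq_mul (D : Subfield E) (d : (↥D)ᵐᵒᵖ) (x : E) :
    d • x = x * (d.unop : E) := rfl

instance (D : Subfield E) : SMulCommClass E (↥D)ᵐᵒᵖ E where
  smul_comm a d x := by simp [Subfield.op_smul_eq_mul, mul_assoc]

/-- The bimodule `E ⊗_D E` underlying the Sweedler coring of `D ⊆ E`. -/
abbrev Sweedler (D : Subfield E) : Type _ := BTensor (↥D) E E

namespace Sweedler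

open BTensor

variable (D : Subfield E)

/-- The element `1 ⊗ 1` of `E ⊗_D E`. -/
def groupLike : Sweedler D := tmul (↥D) 1 1

/-- The additive map `x ⊗ y ↦ (x ⊗ 1) ⊗ (1 ⊗ y)`. -/
def comulAdd : Sweedler D →+ BTensor E (Sweedler D) (Sweedler D) :=
  lift (↥D) (fun x y => tmul E (tmul (↥D) x 1) (tmul (↥D) 1 y))
    (fun m m' n => by rw [add_tmul, add_tmul]) (fun m n n' => by rw [tmul_add, tmul_add])
    (fun m r n => by
      have h1 : tmul (↥D) (op r • m) (1 : E) = op (r : E) • tmul (↥D) m (1 : E) := by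
        rw [smul_tmul, rsmul_tmul]
        simp [Subfield.smul_def]
      have h2 : tmul (↥D) (1 : E) (r • n) = (r : E) • tmul (↥D) (1 : E) n := by
        rw [← smul_tmul, lsmul_tmul]
        simp [Subfield.op_smul_eq_mul]
      rw [h1, h2, smul_tmul])

@[simp]
theorem comulAdd_tmul (x y : E) : comulAdd D (tmul (↥D) x y) =
    tmul E (tmul (↥D) x 1) (tmul (↥D) 1 y) :=
  lift_tmul (↥D) _ _ _ _ x y

/-- The comultiplication `Δ(x ⊗ y) = (x ⊗ 1) ⊗ (1 ⊗ y)`. -/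
def comulHom : BimodHom E (Sweedler D) (BTensor E (Sweedler D) (Sweedler D)) where
  toFun := comulAdd D
  map_add' := map_add _
  map_smul' a t := DFunLike.congr_fun (hom_ext (↥D)
    (f := (comulAdd D).comp (DistribSMul.toAddMonoidHom _ a))
    (g := (DistribSMul.toAddMonoidHom _ a).comp (comulAdd D))
    (by intros; simp)) t
  map_op_smul' a t := DFunLike.congr_fun (hom_ext (↥D)
    (f := (comulAdd D).comp (DistribSMul.toAddMonoidHom _ (op a)))
    (g := (DistribSMul.toAddMonoidHom _ (op a)).comp (comulAdd D))
    (by intros; simp)) t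

@[simp]
theorem comulHom_tmul (x y : E) : comulHom D (tmul (↥D) x y) =
    tmul E (tmul (↥D) x 1) (tmul (↥D) 1 y) :=
  comulAdd_tmul D x y

/-- The additive map `x ⊗ y ↦ x y`. -/
def counitAdd : Sweedler D →+ E :=
  lift (↥D) (fun x y => x * y) add_mul mul_add (fun x d y => mul_assoc x (d : E) y)

@[simp]
theorem counitAdd_tmul (x y : E) : counitAdd D (tmul (↥D) x y) = x * y :=
  lift_tmul (↥D) _ _ _ _ x y

/-- The counit `ε(x ⊗ y) = x y`. -/
def counitHom : BimodHom E (Sweedler D) E where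
  toFun := counitAdd D
  map_add' := map_add _
  map_smul' a t := DFunLike.congr_fun (hom_ext (↥D)
    (f := (counitAdd D).comp (DistribSMul.toAddMonoidHom _ a))
    (g := (DistribSMul.toAddMonoidHom _ a).comp (counitAdd D))
    (by intros; simp [mul_assoc])) t
  map_op_smul' a t := DFunLike.congr_fun (hom_ext (↥D)
    (f := (counitAdd D).comp (DistribSMul.toAddMonoidHom _ (op a)))
    (g := (DistribSMul.toAddMonoidHom _ (op a)).comp (counitAdd D))
    (by intros; simp [mul_assoc])) t

@[simp]
theorem counitHom_tmul (x y : E) : counitHom D (tmul (↥D) x y) = x * y :=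
  counitAdd_tmul D x y

/-- The Sweedler coring `E ⊗_D E`. -/
instance : Coring E (Sweedler D) where
  comul := comulHom D
  counit := counitHom D
  coassoc t := DFunLike.congr_fun (hom_ext (↥D)
    (f := ((assoc E).comp (map E _ _)).comp (comulHom D).toLinearMap.toAddMonoidHom)
    (g := (map E _ _).comp (comulHom D).toLinearMap.toAddMonoidHom)
    (by intros; simp)) t
  counit_left t := DFunLike.congr_fun (hom_ext (↥D)
    (f := ((lid E).comp (map E _ _)).comp (comulHom D).toLinearMap.toAddMonoidHom)
    (g := AddMonoidHom.id _) (by intros; simp)) t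
  counit_right t := DFunLike.congr_fun (hom_ext (↥D)
    (f := ((rid E).comp (map E _ _)).comp (comulHom D).toLinearMap.toAddMonoidHom)
    (g := AddMonoidHom.id _) (by intros; simp)) t

/-- The canonical map `E ⊗_D E → E ⊗_C E`, `x ⊗ y ↦ x ⊗ y`, for `D ⊆ C ⊆ E`. -/
def canonicalMap {D C : Subfield E} (h : D ≤ C) : Sweedler D →+ Sweedler C :=
  lift (↥D) (fun x y => tmul (↥C) x y) (add_tmul (↥C)) (tmul_add (↥C))
    (fun x d y => smul_tmul (↥C) x ⟨d, h d.2⟩ y)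

end Sweedler

end Sweedler

/-! The whole argument runs on group-like elements. In `Q = 𝔠/J` the element `γ = π_J(1 ⊗ 1)` is
group-like and generates `Q` as a bimodule; let `C` be the division ring of all `e` with `e γ = γ
e`.

The key fact (`IsGroupLike.linearIndepOn`) is that left `C`-independent `yᵢ` give left
`E`-independent `γ yᵢ`. If `γ y = ∑ xᵢ γ yᵢ` with independent `γ yᵢ`, then `Δ` gives `∑ xᵢ γ ⊗ γ yᵢ
= ∑ γ xᵢ ⊗ γ yᵢ`, so every `xᵢ` lies in `C`, and `ε` gives `y = ∑ xᵢ yᵢ`, a dependence over `C`.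
Hence `E ⊗_C E → Q`, `x ⊗ y ↦ x γ y`, is injective, and `J` is the kernel of `E ⊗_D E → E ⊗_C E`.
Conversely the commutant of `1 ⊗ 1` in `E ⊗_C E` is exactly `C` (`commutant_groupLike`), so the two
maps are inverse to each other.

The same computation with `Δ` shows that every group-like element of `Q` is `x γ x⁻¹` for some `x ≠
0` (`IsGroupLike.exists_smul_eq_op_smul`). Conjugating `γ` conjugates its commutant, so coring
isomorphisms of quotients correspond to conjugations. -/

/-! ### Tensor products over a division ring: bases and independence. -/

namespace BTensor

variable {R M N ι : Type*} [AddCommGroup M] [AddCommGroup N]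

theorem zero_tmul [Ring R] [Module Rᵐᵒᵖ M] [Module R N] (n : N) : tmul R (0 : M) n = 0 := by
  simpa using add_tmul R (0 : M) 0 n

theorem sub_tmul [Ring R] [Module Rᵐᵒᵖ M] [Module R N] (m m' : M) (n : N) :
    tmul R (m - m') n = tmul R m n - tmul R m' n := by
  rw [eq_sub_iff_add_eq, ← add_tmul, sub_add_cancel]

theorem tmul_sum [Ring R] [Module Rᵐᵒᵖ M] [Module R N] (m : M) (s : Finset ι) (n : ι → N) :
    tmul R m (∑ i ∈ s, n i) = ∑ i ∈ s, tmul R m (n i) :=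
  map_sum (AddMonoidHom.mk' (fun n => tmul R m n) (tmul_add R m)) n s

theorem induction_on [Ring R] [Module Rᵐᵒᵖ M] [Module R N] {p : BTensor R M N → Prop}
    (t : BTensor R M N) (h0 : p 0) (ht : ∀ m n, p (tmul R m n))
    (ha : ∀ t t', p t → p t' → p (t + t')) : p t := by
  obtain ⟨u, rfl⟩ := QuotientAddGroup.mk'_surjective (relations R M N) t
  -- Signs are absorbed into the left factor, so `p` need not be closed under negation.
  have hn : ∀ (m : M) (n : N), -tmul R m n = tmul R (-m) n := fun m n => by
    rw [← zero_sub m, sub_tmul, zero_tmul, zero_sub]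
  refine FreeAbelianGroup.induction_on u ?_ (fun x => ht x.1 x.2) (fun x _ => ?_)
    (fun x y hx hy => ?_)
  · exact h0
  · rw [map_neg]
    exact (hn x.1 x.2) ▸ ht _ _
  · rw [map_add]
    exact ha _ _ hx hy

/-- Every element of `M ⊗_R N` is a combination of the members of an `R`-basis of `N` with
coefficients in `M`. -/
theorem exists_eq_sum_basis [Ring R] [Module Rᵐᵒᵖ M] [Module R N] (b : Module.Basis ι R N)
    (t : BTensor R M N) :
    ∃ (s : Finset ι) (m : ι → M), t = ∑ i ∈ s, tmul R (m i) (b i) := by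
  classical
  -- Finitely supported coefficient families can be added without merging index sets.
  suffices h : ∃ m : ι →₀ M, t = m.sum fun i x => tmul R x (b i) by
    obtain ⟨m, rfl⟩ := h
    exact ⟨m.support, m, rfl⟩
  induction t using induction_on with
  | h0 => exact ⟨0, by simp⟩
  | ht m n =>
    refine ⟨(b.repr n).mapRange (fun r => op r • m) (by simp), ?_⟩
    rw [Finsupp.sum_mapRange_index (h := fun i x => tmul R x (b i)) (fun i => zero_tmul _)]
    conv_lhs => rw [← b.linearCombination_repr n, Finsupp.linearCombination_apply, Finsupp.sum,
      tmul_sum]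
    exact Finset.sum_congr rfl fun i _ => (smul_tmul R m _ _).symm
  | ha t t' h h' =>
    obtain ⟨m, rfl⟩ := h
    obtain ⟨m', rfl⟩ := h'
    exact ⟨m + m', (Finsupp.sum_add_index (by simp [zero_tmul]) (by simp [add_tmul])).symm⟩

/-- Over a division ring, a relation `∑ mᵢ ⊗ nᵢ = 0` with linearly independent `nᵢ` is trivial. -/
theorem eq_zero_of_sum_tmul_eq_zero [DivisionRing R] [Module Rᵐᵒᵖ M] [Module R N] {n : ι → N}
    {s : Finset ι} (hn : LinearIndepOn R n (s : Set ι)) {m : ι → M}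
    (h : ∑ i ∈ s, tmul R (m i) (n i) = 0) : ∀ i ∈ s, m i = 0 := by
  intro i hi
  -- The functional `f` kills the other `nⱼ` but not `nᵢ`, so `id ⊗ f` turns the relation into `mᵢ
  -- f(nᵢ) = 0`.
  obtain ⟨f, hfi, hf⟩ := Submodule.exists_le_ker_of_notMem
    (linearIndepOn_iff_notMem_span.1 hn i hi)
  have h' := congrArg (fun t => rid R (map R LinearMap.id f t)) h
  simp only [map_sum, map_tmul, rid_tmul, map_zero, LinearMap.id_apply] at h'
  rw [Finset.sum_eq_single_of_mem i hi fun j hj hji => ?_] at h'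
  · exact (smul_eq_zero.1 h').resolve_left ((op_ne_zero_iff _).2 hfi)
  · rw [LinearMap.mem_ker.1 (hf (Submodule.subset_span ⟨j, ⟨hj, hji⟩, rfl⟩)), op_zero, zero_smul]

end BTensor

/-! ### Kernels and quotients of coring homomorphisms. -/

namespace BimodHom

variable {A M N : Type*} [Ring A] [AddCommGroup M] [Module A M] [Module Aᵐᵒᵖ M]
  [AddCommGroup N] [Module A N] [Module Aᵐᵒᵖ N]

/-- The kernel of a bimodule map. -/
def ker (f : BimodHom A M N) : SubBimodule A M where
  toAddSubgroup := f.toLinearMap.toAddMonoidHom.ker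
  smul_mem' a x hx := by
    change f (a • x) = 0
    rw [map_smul, show f x = 0 from hx, smul_zero]
  op_smul_mem' a x hx := by
    change f (op a • x) = 0
    rw [toLinearMap_op_smul, show f x = 0 from hx, smul_zero]

theorem mem_ker {f : BimodHom A M N} {x : M} : x ∈ f.ker.toAddSubgroup ↔ f x = 0 := Iff.rfl

/-- The map `N → P` through which `g : M → P` factors along a surjection `f : M → N` with
`ker f ⊆ ker g`. -/
noncomputable def factor {P : Type*} [AddCommGroup P] [Module A P] [Module Aᵐᵒᵖ P]
    (f : BimodHom A M N) (hf : Function.Surjective f) (g : BimodHom A M P)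
    (h : ∀ x, f x = 0 → g x = 0) : BimodHom A N P :=
  have h' : ∀ x y, f x = f y → g x = g y := fun x y e => by
    rw [← sub_eq_zero, ← map_sub] at e ⊢
    exact h _ e
  have hs := Function.surjInv_eq hf
  { toFun := fun n => g (Function.surjInv hf n)
    map_add' := fun x y => by rw [← map_add]; exact h' _ _ (by simp only [map_add, hs])
    map_smul' := fun a x => by
      rw [RingHom.id_apply, ← map_smul]; exact h' _ _ (by simp only [map_smul, hs])
    map_op_smul' := fun a x => by
      rw [← toLinearMap_op_smul]; exact h' _ _ (by simp only [toLinearMap_op_smul, hs]) }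

theorem factor_apply {P : Type*} [AddCommGroup P] [Module A P] [Module Aᵐᵒᵖ P]
    (f : BimodHom A M N) (hf : Function.Surjective f) (g : BimodHom A M P)
    (h : ∀ x, f x = 0 → g x = 0) (x : M) : f.factor hf g h (f x) = g x := by
  change g (Function.surjInv hf (f x)) = g x
  rw [← sub_eq_zero, ← map_sub]
  exact h _ (by rw [map_sub, Function.surjInv_eq hf, sub_self])

end BimodHom

namespace CoringHom

variable {A C C' : Type*} [Ring A]
  [AddCommGroup C] [Module A C] [Module Aᵐᵒᵖ C] [SMulCommClass A Aᵐᵒᵖ C] [Coring A C]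
  [AddCommGroup C'] [Module A C'] [Module Aᵐᵒᵖ C'] [SMulCommClass A Aᵐᵒᵖ C'] [Coring A C']

/-- The kernel of a surjective homomorphism of corings is a coideal. -/
def kerCoideal (f : CoringHom A C C') (hf : Function.Surjective f.toBimodHom) :
    Coideal A C where
  toSubBimodule := f.toBimodHom.ker
  counit_eq_zero x hx := by
    rw [← f.map_counit, BimodHom.mem_ker.1 hx, map_zero]
  comul_eq_zero x hx := by
    -- The projection factors as `π = h ∘ f`, so `π ⊗ π` factors through `f ⊗ f`, and `(f ⊗ f)(Δ x)
    -- = Δ(f x) = 0`.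
    let h := f.toBimodHom.factor hf f.toBimodHom.ker.proj
      fun x hx => (SubBimodule.mkHom_eq_zero _).2 hx
    have hh : ∀ t, f.toBimodHom.ker.proj.tensorSq t = h.tensorSq (f.toBimodHom.tensorSq t) := by
      refine fun t => DFunLike.congr_fun (BTensor.hom_ext A
        (g := h.tensorSq.comp f.toBimodHom.tensorSq) fun m n => ?_) t
      simp only [BimodHom.tensorSq, AddMonoidHom.comp_apply, BTensor.map_tmul,
        BimodHom.right_apply, BimodHom.left_apply]
      exact congrArg₂ _ (BimodHom.factor_apply ..).symm (BimodHom.factor_apply ..).symm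
    rw [hh, ← f.map_comul, BimodHom.mem_ker.1 hx, map_zero, map_zero]

/-- A surjective homomorphism of corings with kernel `J` identifies `C / J` with its target. -/
theorem coringsIsomorphic_quot (f : CoringHom A C C') (hf : Function.Surjective f.toBimodHom)
    (J : Coideal A C) (hJ : ∀ x, x ∈ J.toAddSubgroup ↔ f.toBimodHom x = 0) :
    CoringsIsomorphic A J.Quot C' := by
  let φ := J.liftQuot f.toBimodHom fun x hx => (hJ x).1 hx
  have hφ : ∀ x, φ (J.proj x) = f.toBimodHom x := fun x => rfl
  refine ⟨⟨φ, J.proj_surjective.forall.2 fun c => ?_, J.proj_surjective.forall.2 fun c => ?_⟩,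
    ?_, fun y => ?_⟩
  · rw [hφ, f.map_comul]
    exact DFunLike.congr_fun (BTensor.hom_ext A (f := f.toBimodHom.tensorSq)
      (g := φ.tensorSq.comp J.proj.tensorSq) fun m n => by
        simp [BimodHom.tensorSq, hφ]) _
  · rw [hφ, f.map_counit, ← J.projHom.map_counit c]
    rfl
  · refine (injective_iff_map_eq_zero φ.toLinearMap).2 (J.proj_surjective.forall.2 fun c hc => ?_)
    exact (SubBimodule.mkHom_eq_zero _).2 ((hJ c).2 hc)
  · obtain ⟨x, rfl⟩ := hf y
    exact ⟨J.proj x, rfl⟩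

end CoringHom

theorem Coideal.ext_of_mem {A C : Type*} [Ring A] [AddCommGroup C] [Module A C] [Module Aᵐᵒᵖ C]
    [SMulCommClass A Aᵐᵒᵖ C] [Coring A C] {I J : Coideal A C}
    (h : ∀ x, x ∈ I.toAddSubgroup ↔ x ∈ J.toAddSubgroup) : I = J := by
  obtain ⟨⟨I, _, _⟩, _, _⟩ := I
  obtain ⟨⟨J, _, _⟩, _, _⟩ := J
  obtain rfl : I = J := AddSubgroup.ext h
  rfl

@[simp]
theorem Sweedler.canonicalMap_tmul {E : Type*} [DivisionRing E] {D C : Subfield E} (h : D ≤ C)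
    (x y : E) : canonicalMap h (BTensor.tmul (↥D) x y) = BTensor.tmul (↥C) x y :=
  BTensor.lift_tmul (↥D) _ _ _ _ x y

/-! ### Commutants of elements and maps out of the Sweedler coring. -/

namespace Coring

/-- If a relation `∑ γ xᵢ ⊗ γ yᵢ = ∑ xᵢ γ' ⊗ γ yᵢ` holds with linearly independent
`γ yᵢ`, then `xᵢ γ' = γ xᵢ` for all `i`. -/
theorem smul_eq_op_smul_of_sum {E Q ι : Type*} [DivisionRing E] [AddCommGroup Q] [Module E Q]
    [Module Eᵐᵒᵖ Q] {s : Finset ι} {γ γ' γ'' : Q} {x y : ι → E}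
    (hy : LinearIndepOn E (fun i => op (y i) • γ'') (s : Set ι))
    (h : ∑ i ∈ s, BTensor.tmul E (x i • γ') (op (y i) • γ'') =
      BTensor.tmul E γ (∑ i ∈ s, x i • op (y i) • γ'')) :
    ∀ i ∈ s, x i • γ' = op (x i) • γ := by
  intro i hi
  -- Moving each `xᵢ` across the tensor sign on the right side leaves `∑ (xᵢ γ' - γ xᵢ) ⊗ γ'' yᵢ =
  -- 0`.
  refine sub_eq_zero.1 (BTensor.eq_zero_of_sum_tmul_eq_zero hy
    (m := fun i => x i • γ' - op (x i) • γ) ?_ i hi)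
  simp only [BTensor.sub_tmul, Finset.sum_sub_distrib, h, BTensor.smul_tmul, BTensor.tmul_sum,
    sub_self]

variable {E Q : Type*} [DivisionRing E] [AddCommGroup Q] [Module E Q] [Module Eᵐᵒᵖ Q]
  [SMulCommClass E Eᵐᵒᵖ Q]

/-- The division subring of all `e` with `e γ = γ e`. -/
def commutant (γ : Q) : Subfield E where
  carrier := {e | e • γ = op e • γ}
  zero_mem' := by simp
  one_mem' := by simp
  add_mem' {a b} ha hb := by
    simp only [Set.mem_ofPred_eq] at *
    rw [add_smul, op_add, add_smul, ha, hb]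
  neg_mem' {a} ha := by
    simp only [Set.mem_ofPred_eq] at *
    rw [neg_smul, op_neg, neg_smul, ha]
  mul_mem' {a b} ha hb := by
    simp only [Set.mem_ofPred_eq] at *
    rw [mul_smul, hb, smul_comm, ha, op_mul, mul_smul]
  inv_mem' a ha := by
    simp only [Set.mem_ofPred_eq] at *
    -- Zero is separate because `0⁻¹ = 0`; otherwise `a γ = γ a` is multiplied by `a⁻¹` on both
    -- sides.
    rcases eq_or_ne a 0 with rfl | h0
    · simp
    · have h := congrArg (fun q => a⁻¹ • op a⁻¹ • q) ha
      rw [smul_comm a⁻¹ (op a⁻¹) (a • γ), smul_smul a⁻¹ a, inv_mul_cancel₀ h0, one_smul,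
        smul_smul (op a⁻¹) (op a), ← op_mul, mul_inv_cancel₀ h0, op_one, one_smul] at h
      exact h.symm

theorem mem_commutant {γ : Q} {e : E} : e ∈ commutant γ ↔ e • γ = op e • γ := Iff.rfl

/-- The additive map `E ⊗_D E → Q`, `x ⊗ y ↦ x γ y`, for `γ` commuting with `D`. -/
def fromSweedlerAdd (D : Subfield E) (γ : Q) (hD : D ≤ commutant γ) : Sweedler D →+ Q :=
  BTensor.lift (↥D) (fun x y => x • op y • γ)
    (fun _ _ _ => add_smul _ _ _) (fun _ _ _ => by rw [op_add, add_smul, smul_add])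
    (fun x d y => by
      rw [Subfield.op_smul_eq_mul, unop_op, Subfield.smul_def, smul_eq_mul, op_mul, mul_smul,
        mul_smul (op y), ← mem_commutant.1 (hD d.2), smul_comm (d : E) (op y)])

@[simp]
theorem fromSweedlerAdd_tmul (D : Subfield E) (γ : Q) (hD : D ≤ commutant γ) (x y : E) :
    fromSweedlerAdd D γ hD (BTensor.tmul (↥D) x y) = x • op y • γ :=
  BTensor.lift_tmul (↥D) _ _ _ _ x y

/-- The bimodule map `E ⊗_D E → Q`, `x ⊗ y ↦ x γ y`, for `γ` commuting with `D`. -/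
def fromSweedlerBimod (D : Subfield E) (γ : Q) (hD : D ≤ commutant γ) :
    BimodHom E (Sweedler D) Q where
  toFun := fromSweedlerAdd D γ hD
  map_add' := map_add _
  map_smul' a t := DFunLike.congr_fun (BTensor.hom_ext (↥D)
    (f := (fromSweedlerAdd D γ hD).comp (DistribSMul.toAddMonoidHom _ a))
    (g := (DistribSMul.toAddMonoidHom _ a).comp (fromSweedlerAdd D γ hD))
    (by intros; simp [mul_smul])) t
  map_op_smul' a t := DFunLike.congr_fun (BTensor.hom_ext (↥D)
    (f := (fromSweedlerAdd D γ hD).comp (DistribSMul.toAddMonoidHom _ (op a)))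
    (g := (DistribSMul.toAddMonoidHom _ (op a)).comp (fromSweedlerAdd D γ hD))
    (by intro x y; simp [mul_smul, smul_comm x (op a)])) t

@[simp]
theorem fromSweedlerBimod_tmul (D : Subfield E) (γ : Q) (hD : D ≤ commutant γ) (x y : E) :
    fromSweedlerBimod D γ hD (BTensor.tmul (↥D) x y) = x • op y • γ :=
  fromSweedlerAdd_tmul D γ hD x y

/-- Lets questions about `E ⊗_D E` be moved to `E ⊗_C E` with `C` the full commutant of `γ`. -/
theorem fromSweedlerBimod_canonicalMap {D C : Subfield E} (hDC : D ≤ C) (γ : Q)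
    (hC : C ≤ commutant γ) (t : Sweedler D) :
    fromSweedlerBimod C γ hC (Sweedler.canonicalMap hDC t) =
      fromSweedlerBimod D γ (hDC.trans hC) t :=
  DFunLike.congr_fun (BTensor.hom_ext (↥D)
    (f := (fromSweedlerBimod C γ hC).toLinearMap.toAddMonoidHom.comp (Sweedler.canonicalMap hDC))
    (g := (fromSweedlerBimod D γ (hDC.trans hC)).toLinearMap.toAddMonoidHom) fun x y => by
      simp) t

/-- The commutant of a conjugate: if `x γ = γ' x` then `e` commutes with `γ'` if and only if
`x⁻¹ e x` commutes with `γ`. -/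
theorem mem_commutant_of_smul_eq {γ γ' : Q} {x : E} (hx : x ≠ 0) (h : x • γ = op x • γ') (e : E) :
    e ∈ commutant γ' ↔ x⁻¹ * e * x ∈ commutant γ := by
  have hγ' : γ' = x • op x⁻¹ • γ := by
    rw [smul_comm, h, smul_smul, ← op_mul, mul_inv_cancel₀ hx, op_one, one_smul]
  -- Multiplying `e γ' = γ' e` by `x⁻¹` on the left and `x` on the right gives `(x⁻¹ e x) γ = γ (x⁻¹
  -- e x)`, and this operation is invertible.
  have hl : x⁻¹ • op x • e • γ' = (x⁻¹ * e * x) • γ := by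
    rw [← smul_comm e (op x), ← h]; simp only [smul_smul, mul_assoc]
  have hr : x⁻¹ • op x • op e • γ' = op (x⁻¹ * e * x) • γ := by
    rw [hγ', ← smul_comm x (op e), ← smul_comm x (op x), smul_smul x⁻¹ x, inv_mul_cancel₀ hx, one_smul]
    simp only [smul_smul, op_mul, mul_assoc]
  rw [mem_commutant, mem_commutant, ← hl, ← hr]
  refine ⟨fun h => by rw [h], fun h => ?_⟩
  exact (isUnit_iff_ne_zero.2 ((op_ne_zero_iff x).2 hx)).smul_left_cancel.1
    ((isUnit_iff_ne_zero.2 (inv_ne_zero hx)).smul_left_cancel.1 h)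

/-! ### Group-like elements. -/

variable [Coring E Q]

/-- An element `γ` of a coring with `Δ γ = γ ⊗ γ` and `ε γ = 1`. -/
structure IsGroupLike (γ : Q) : Prop where
  comul_eq : Coring.comul (A := E) γ = BTensor.tmul E γ γ
  counit_eq : Coring.counit (A := E) γ = 1

theorem IsGroupLike.map {Q' : Type*} [AddCommGroup Q'] [Module E Q'] [Module Eᵐᵒᵖ Q']
    [SMulCommClass E Eᵐᵒᵖ Q'] [Coring E Q'] (f : CoringHom E Q Q') {γ : Q}
    (h : IsGroupLike (E := E) γ) : IsGroupLike (E := E) (f.toBimodHom γ) where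
  comul_eq := by simp [f.map_comul, h.comul_eq, BimodHom.tensorSq]
  counit_eq := by rw [f.map_counit, h.counit_eq]

theorem IsGroupLike.comul_smul {γ : Q} (h : IsGroupLike (E := E) γ) (x y : E) :
    Coring.comul (A := E) (x • op y • γ) = BTensor.tmul E (x • γ) (op y • γ) := by
  rw [map_smul, BimodHom.toLinearMap_op_smul, h.comul_eq, BTensor.rsmul_tmul, BTensor.lsmul_tmul]

theorem IsGroupLike.counit_smul {γ : Q} (h : IsGroupLike (E := E) γ) (x y : E) :
    Coring.counit (A := E) (x • op y • γ) = x * y := by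
  rw [map_smul, BimodHom.toLinearMap_op_smul, h.counit_eq]
  simp

/-- The conjugate `x γ x⁻¹` of a group-like element is group-like. -/
theorem IsGroupLike.conj {γ : Q} (h : IsGroupLike (E := E) γ) {x y : E} (hyx : y * x = 1)
    (hxy : x * y = 1) : IsGroupLike (E := E) (x • op y • γ) where
  comul_eq := by
    -- In `(x γ y) ⊗ (x γ y)` the inner `y` crosses the tensor sign and cancels against `x`.
    rw [h.comul_smul, smul_comm x (op y) γ, BTensor.smul_tmul, ← smul_comm x (op y) γ, smul_smul y x, hyx,
      one_smul]
  counit_eq := by rw [h.counit_smul, hxy]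

/-- If `γ` is group-like and the `yᵢ` are left linearly independent over the commutant of `γ`,
then the elements `γ yᵢ` are left linearly independent over `E`. -/
theorem IsGroupLike.linearIndepOn {γ : Q} (h : IsGroupLike (E := E) γ) {ι : Type*} {y : ι → E}
    (hy : LinearIndependent (commutant (E := E) γ) y) (s : Finset ι) :
    LinearIndepOn E (fun i => op (y i) • γ) (s : Set ι) := by
  classical
  induction s using Finset.induction_on with
  | empty => simp
  | insert a s ha ih =>
    rw [Finset.coe_insert, linearIndepOn_insert (by simpa using ha)]
    refine ⟨ih, fun hmem => ?_⟩
    obtain ⟨x, hxs, hx⟩ := (Finsupp.mem_span_image_iff_linearCombination E).1 hmem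
    rw [Finsupp.linearCombination_apply_of_mem_supported E hxs] at hx
    -- Applying `Δ` to `∑ xᵢ γ yᵢ = γ yₐ` and substituting the relation back into `γ ⊗ γ yₐ` forces
    -- `xᵢ γ = γ xᵢ`.
    have hΔ := congrArg (Coring.comul (A := E)).toLinearMap hx
    rw [map_sum] at hΔ
    simp only [h.comul_smul] at hΔ
    have h1 := h.comul_smul 1 (y a)
    rw [one_smul, one_smul] at h1
    rw [h1, ← hx] at hΔ
    have hc := smul_eq_op_smul_of_sum ih hΔ
    -- Applying `ε` gives `∑ xᵢ yᵢ = yₐ`, now with all `xᵢ` in the commutant, against the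
    -- independence of `y`.
    have hε := congrArg (Coring.counit (A := E)).toLinearMap hx
    rw [map_sum] at hε
    simp only [h.counit_smul] at hε
    have h2 := h.counit_smul 1 (y a)
    rw [one_smul, one_mul] at h2
    rw [h2] at hε
    have hya : y a ∈ Submodule.span (commutant (E := E) γ) (y '' (s : Set ι)) := by
      rw [← hε]
      exact Submodule.sum_mem _ fun i hi => Submodule.smul_mem _
        (⟨x i, mem_commutant.2 (hc i hi)⟩ : commutant (E := E) γ)
        (Submodule.subset_span ⟨i, hi, rfl⟩)
    exact hy.notMem_span_image (by simpa using ha) hya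

/-- The homomorphism of corings `E ⊗_D E → Q`, `x ⊗ y ↦ x γ y`, for a group-like element `γ`
commuting with `D`. -/
def fromSweedler (D : Subfield E) {γ : Q} (hD : D ≤ commutant γ) (h : IsGroupLike (E := E) γ) :
    CoringHom E (Sweedler D) Q where
  toBimodHom := fromSweedlerBimod D γ hD
  map_comul t := DFunLike.congr_fun (BTensor.hom_ext (↥D)
    (f := (Coring.comul (A := E) (C := Q)).toLinearMap.toAddMonoidHom.comp
      (fromSweedlerBimod D γ hD).toLinearMap.toAddMonoidHom)
    (g := (fromSweedlerBimod D γ hD).tensorSq.comp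
      (Sweedler.comulHom D).toLinearMap.toAddMonoidHom) fun x y => by
        simpa [BimodHom.tensorSq] using h.comul_smul x y) t
  map_counit t := DFunLike.congr_fun (BTensor.hom_ext (↥D)
    (f := (Coring.counit (A := E) (C := Q)).toLinearMap.toAddMonoidHom.comp
      (fromSweedlerBimod D γ hD).toLinearMap.toAddMonoidHom)
    (g := (Sweedler.counitHom D).toLinearMap.toAddMonoidHom) fun x y => by
        simpa using h.counit_smul x y) t

/-- For group-like `γ` with commutant `C`, the map `E ⊗_C E → Q`, `x ⊗ y ↦ x γ y`, is injective. -/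
theorem IsGroupLike.fromSweedlerBimod_injective {γ : Q} (h : IsGroupLike (E := E) γ) :
    Function.Injective (fromSweedlerBimod (commutant (E := E) γ) γ le_rfl) := by
  refine (injective_iff_map_eq_zero
    (fromSweedlerBimod (commutant (E := E) γ) γ le_rfl).toLinearMap).2 fun t ht => ?_
  -- With right factors in a left basis `b` of `E` over the commutant, the image of `t` is `∑ xᵢ γ
  -- bᵢ`, and the `γ bᵢ` are independent over `E`.
  let b := Module.Basis.ofVectorSpace (commutant (E := E) γ) E
  obtain ⟨s, x, rfl⟩ := BTensor.exists_eq_sum_basis b t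
  simp only [map_sum, fromSweedlerBimod_tmul] at ht
  have hx := linearIndepOn_finset_iff.1 (h.linearIndepOn b.linearIndependent s) x ht
  exact Finset.sum_eq_zero fun i hi => by rw [hx i hi, BTensor.zero_tmul]

/-- The map factors through the tensor product over the commutant of `γ`, on which it is injective.
This is what identifies coideals as kernels of canonical maps. -/
theorem IsGroupLike.fromSweedlerBimod_eq_zero_iff {D : Subfield E} {γ : Q}
    (h : IsGroupLike (E := E) γ) (hD : D ≤ commutant γ) (t : Sweedler D) :
    fromSweedlerBimod D γ hD t = 0 ↔ Sweedler.canonicalMap hD t = 0 := by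
  rw [← fromSweedlerBimod_canonicalMap hD γ le_rfl]
  exact map_eq_zero_iff (fromSweedlerBimod (commutant (E := E) γ) γ le_rfl).toLinearMap
    h.fromSweedlerBimod_injective

/-- If `γ` generates `Q` as a bimodule, then every group-like element is conjugate to `γ`. -/
theorem IsGroupLike.exists_smul_eq_op_smul {γ γ' : Q} (h : IsGroupLike (E := E) γ)
    (hγ : Function.Surjective (fromSweedlerBimod (commutant (E := E) γ) γ le_rfl))
    (h' : IsGroupLike (E := E) γ') : ∃ x : E, x ≠ 0 ∧ x • γ = op x • γ' := by
  obtain ⟨t, ht⟩ := hγ γ'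
  let b := Module.Basis.ofVectorSpace (commutant (E := E) γ) E
  obtain ⟨s, x, rfl⟩ := BTensor.exists_eq_sum_basis b t
  simp only [map_sum, fromSweedlerBimod_tmul] at ht
  -- With `γ' = ∑ xᵢ γ bᵢ`, the equality `Δ γ' = γ' ⊗ γ'` reads `∑ xᵢ γ ⊗ γ bᵢ = ∑ γ' xᵢ ⊗ γ bᵢ`, so
  -- `xᵢ γ = γ' xᵢ` for all `i`.
  have hΔ := congrArg (Coring.comul (A := E)).toLinearMap ht
  rw [map_sum, h'.comul_eq] at hΔ
  simp only [h.comul_smul] at hΔ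
  have hc := smul_eq_op_smul_of_sum (h.linearIndepOn b.linearIndependent s)
    (hΔ.trans (congrArg (BTensor.tmul E γ') ht.symm))
  -- If no nonzero `x` works, all `xᵢ` vanish and `γ' = 0`, contradicting `ε γ' = 1`.
  by_contra! hx
  have h0 : γ' = 0 := by
    rw [← ht]
    exact Finset.sum_eq_zero fun i hi => by
      by_cases hi0 : x i = 0
      · rw [hi0, zero_smul]
      · exact absurd (hc i hi) (hx _ hi0)
  have := h'.counit_eq
  rw [h0, map_zero] at this
  exact zero_ne_one this

end Coring

/-! ### The group-like element `1 ⊗ 1` of the Sweedler coring. -/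

namespace Sweedler

variable {E : Type*} [DivisionRing E]

theorem isGroupLike_groupLike (D : Subfield E) : Coring.IsGroupLike (E := E) (groupLike D) where
  comul_eq := comulHom_tmul D 1 1
  counit_eq := (counitHom_tmul D 1 1).trans (one_mul 1)

theorem smul_op_smul_groupLike (D : Subfield E) (x y : E) :
    x • op y • groupLike D = BTensor.tmul (↥D) x y := by simp [groupLike]

/-- `D` is the commutant of `1 ⊗ 1` in `E ⊗_D E`. -/
theorem commutant_groupLike (D : Subfield E) : Coring.commutant (groupLike D) = D := by
  ext e
  rw [Coring.mem_commutant]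
  simp only [groupLike, BTensor.lsmul_tmul, BTensor.rsmul_tmul, smul_eq_mul, mul_one,
    op_smul_eq_mul, one_mul]
  refine ⟨fun h => ?_, fun h => ?_⟩
  · by_contra he
    -- For `e ∉ D` the pair `1, e` is independent over `D`, so `e ⊗ 1 + (-1) ⊗ e = 0` would force
    -- `-1 = 0`.
    have hind : LinearIndependent D ![(1 : E), e] := by
      rw [LinearIndependent.pair_iff' one_ne_zero]
      rintro a rfl
      exact he (by simp [Subfield.smul_def])
    have := BTensor.eq_zero_of_sum_tmul_eq_zero (R := D) (s := Finset.univ) (m := ![e, (-1 : E)])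
      (by simpa using hind) (by
        simp only [Fin.sum_univ_two, Matrix.cons_val_zero, Matrix.cons_val_one]
        rw [h, ← BTensor.add_tmul, add_neg_cancel, BTensor.zero_tmul]) 1 (Finset.mem_univ _)
    simp at this
  · have := BTensor.smul_tmul (↥D) (1 : E) ⟨e, h⟩ (1 : E)
    simpa [Subfield.op_smul_eq_mul, Subfield.smul_def] using this

end Sweedler

/-! ### The correspondence between coideals and intermediate division rings. -/

namespace Sweedler

open Coring

variable {E : Type*} [DivisionRing E] {D : Subfield E}

theorem le_commutant_groupLike {C : Subfield E} (h : D ≤ C) : D ≤ commutant (groupLike C) :=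
  h.trans (commutant_groupLike C).ge

/-- The canonical map `E ⊗_D E → E ⊗_C E` as a homomorphism of corings. -/
def canonicalHom {C : Subfield E} (h : D ≤ C) : CoringHom E (Sweedler D) (Sweedler C) :=
  fromSweedler D (le_commutant_groupLike h) (isGroupLike_groupLike C)

/-- Joins two descriptions: the one by a group-like element respects `Δ` and `ε`, the other is the
explicit map whose kernel is wanted. -/
theorem canonicalHom_apply {C : Subfield E} (h : D ≤ C) (t : Sweedler D) :
    (canonicalHom h).toBimodHom t = canonicalMap h t :=
  DFunLike.congr_fun (BTensor.hom_ext (↥D)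
    (f := (canonicalHom h).toLinearMap.toAddMonoidHom) (g := canonicalMap h) fun x y =>
      (fromSweedlerBimod_tmul D _ (le_commutant_groupLike h) x y).trans
        ((smul_op_smul_groupLike C x y).trans (canonicalMap_tmul h x y).symm)) t

theorem canonicalHom_surjective {C : Subfield E} (h : D ≤ C) :
    Function.Surjective (canonicalHom h).toBimodHom := by
  intro t
  induction t using BTensor.induction_on with
  | h0 => exact ⟨0, map_zero _⟩
  | ht x y => exact ⟨BTensor.tmul _ x y, by rw [canonicalHom_apply, canonicalMap_tmul]⟩
  | ha t t' h h' =>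
    obtain ⟨u, rfl⟩ := h
    obtain ⟨u', rfl⟩ := h'
    exact ⟨u + u', map_add _ _ _⟩

/-- The coideal `ker (E ⊗_D E → E ⊗_C E)`. -/
def coidealOf {C : Subfield E} (h : D ≤ C) : Coideal E (Sweedler D) :=
  (canonicalHom h).kerCoideal (canonicalHom_surjective h)

theorem mem_coidealOf {C : Subfield E} (h : D ≤ C) (t : Sweedler D) :
    t ∈ (coidealOf h).toAddSubgroup ↔ canonicalMap h t = 0 := by
  rw [← canonicalHom_apply]; rfl

/-- The element `π_J (1 ⊗ 1)`. -/
def projGroupLike (J : Coideal E (Sweedler D)) : J.Quot := J.proj (groupLike D)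

theorem isGroupLike_projGroupLike (J : Coideal E (Sweedler D)) :
    IsGroupLike (E := E) (projGroupLike J) :=
  (isGroupLike_groupLike D).map J.projHom

theorem le_commutant_projGroupLike (J : Coideal E (Sweedler D)) :
    D ≤ commutant (projGroupLike J) := by
  intro d hd
  rw [← commutant_groupLike D, mem_commutant] at hd
  rw [mem_commutant, projGroupLike, ← map_smul, hd, BimodHom.toLinearMap_op_smul]

/-- Since `x ⊗ y = x (1 ⊗ 1) y`, the projection is the map attached to the group-like element `π_J(1
⊗ 1)`, so the results on such maps apply to it. -/
theorem fromSweedlerBimod_projGroupLike (J : Coideal E (Sweedler D)) (t : Sweedler D) :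
    fromSweedlerBimod D (projGroupLike J) (le_commutant_projGroupLike J) t = J.proj t :=
  DFunLike.congr_fun (BTensor.hom_ext (↥D)
    (f := (fromSweedlerBimod D _ (le_commutant_projGroupLike J)).toLinearMap.toAddMonoidHom)
    (g := J.proj.toLinearMap.toAddMonoidHom) fun x y => by
      refine (fromSweedlerBimod_tmul D _ (le_commutant_projGroupLike J) x y).trans ?_
      rw [← smul_op_smul_groupLike]
      simp [projGroupLike]) t

theorem fromSweedlerBimod_projGroupLike_surjective (J : Coideal E (Sweedler D)) :
    Function.Surjective (fromSweedlerBimod (commutant (E := E) (projGroupLike J))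
      (projGroupLike J) le_rfl) := by
  refine J.proj_surjective.forall.2 fun t => ⟨canonicalMap (le_commutant_projGroupLike J) t, ?_⟩
  rw [fromSweedlerBimod_canonicalMap, fromSweedlerBimod_projGroupLike]

/-- Both sides are kernels: `J` is that of `π_J`, which vanishes exactly where the canonical map to
the tensor product over the commutant does. -/
theorem coidealOf_commutant (J : Coideal E (Sweedler D)) :
    coidealOf (le_commutant_projGroupLike J) = J := by
  refine Coideal.ext_of_mem fun t => ?_
  rw [mem_coidealOf, ← (isGroupLike_projGroupLike J).fromSweedlerBimod_eq_zero_iff,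
    fromSweedlerBimod_projGroupLike]
  exact SubBimodule.mkHom_eq_zero _

/-- Commuting with `π_J(1 ⊗ 1)` means that `e (1 ⊗ 1) - (1 ⊗ 1) e` lies in the kernel, i.e. that `e`
commutes with `1 ⊗ 1` in `E ⊗_C E`, whose commutant is `C`. -/
theorem commutant_coidealOf {C : Subfield E} (h : D ≤ C) :
    commutant (projGroupLike (coidealOf h)) = C := by
  ext e
  rw [mem_commutant, projGroupLike, ← map_smul, ← BimodHom.toLinearMap_op_smul, ← sub_eq_zero,
    ← map_sub]
  refine (SubBimodule.mkHom_eq_zero _).trans ?_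
  rw [mem_coidealOf, map_sub, sub_eq_zero]
  conv_rhs => rw [← commutant_groupLike C, mem_commutant]
  simp [groupLike]

variable (D) in
/-- The correspondence between coideals of `E ⊗_D E` and intermediate division rings. -/
def coidealEquiv : Coideal E (Sweedler D) ≃ {C : Subfield E // D ≤ C} where
  toFun J := ⟨commutant (projGroupLike J), le_commutant_projGroupLike J⟩
  invFun C := coidealOf C.2
  left_inv J := coidealOf_commutant J
  right_inv C := Subtype.ext (commutant_coidealOf C.2)

/-! ### Isomorphic quotients and conjugate division rings. -/

/-- The quotient corings of two coideals are isomorphic if and only if the corresponding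
intermediate division rings are conjugate. -/
theorem coringsIsomorphic_iff (J J' : Coideal E (Sweedler D)) :
    CoringsIsomorphic E J.Quot J'.Quot ↔ ∃ x : E, x ≠ 0 ∧
      ∀ e, e ∈ commutant (projGroupLike J) ↔ x * e * x⁻¹ ∈ commutant (projGroupLike J') := by
  constructor
  · rintro ⟨f, hf⟩
    obtain ⟨x, hx, h⟩ := (isGroupLike_projGroupLike J').exists_smul_eq_op_smul
      (fromSweedlerBimod_projGroupLike_surjective J') ((isGroupLike_projGroupLike J).map f)
    -- Here `f` sends `π_J(1 ⊗ 1)` to `x γ x⁻¹` with `γ = π_{J'}(1 ⊗ 1)`; injectivity of `f`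
    -- preserves the commutant, so the conjugation towards that of `γ` is by `x⁻¹`.
    refine ⟨x⁻¹, inv_ne_zero hx, fun e => ?_⟩
    rw [inv_inv, ← mem_commutant_of_smul_eq hx h, mem_commutant, mem_commutant, ← map_smul,
      ← BimodHom.toLinearMap_op_smul]
    exact hf.1.eq_iff.symm
  · rintro ⟨x, hx, h⟩
    -- This conjugate has the same commutant as `π_J(1 ⊗ 1)`. Hence `a ⊗ b ↦ a γ' b` has kernel `J`,
    -- and it maps onto `J'.Quot`.
    set γ' : J'.Quot := x⁻¹ • op x • projGroupLike J' with hγ'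
    have hconj : IsGroupLike (E := E) γ' := (isGroupLike_projGroupLike J').conj
      (mul_inv_cancel₀ hx) (inv_mul_cancel₀ hx)
    have hc : commutant (E := E) γ' = commutant (projGroupLike J) := by
      ext e
      have hxγ : x⁻¹ • projGroupLike J' = op x⁻¹ • γ' := by
        rw [hγ', ← smul_comm x⁻¹ (op x⁻¹), smul_smul (op x⁻¹), ← op_mul, mul_inv_cancel₀ hx,
          op_one, one_smul]
      rw [h, mem_commutant_of_smul_eq (inv_ne_zero hx) hxγ, inv_inv]
    have hD : D ≤ commutant γ' := hc ▸ le_commutant_projGroupLike J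
    refine (fromSweedler D hD hconj).coringsIsomorphic_quot ?_ J fun t => ?_
    · refine J'.proj_surjective.forall.2 fun t => ?_
      induction t using BTensor.induction_on with
      | h0 => exact ⟨0, by simp⟩
      | ht a b =>
        -- The factors undo the conjugation: `(a x) γ' (x⁻¹ b) = a γ b` with `γ = π_{J'}(1 ⊗ 1)`.
        refine ⟨BTensor.tmul _ (a * x) (x⁻¹ * b), ?_⟩
        refine (fromSweedlerBimod_tmul D γ' hD _ _).trans ?_
        rw [← fromSweedlerBimod_projGroupLike, fromSweedlerBimod_tmul, hγ',
          ← smul_comm x⁻¹ (op (x⁻¹ * b)), smul_smul (a * x), smul_smul (op (x⁻¹ * b)), ← op_mul,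
          mul_inv_cancel_right₀ hx, mul_inv_cancel_left₀ hx]
      | ha t t' h h' =>
        obtain ⟨u, hu⟩ := h
        obtain ⟨u', hu'⟩ := h'
        exact ⟨u + u', by rw [map_add, map_add, hu, hu']⟩
    · refine Iff.trans ?_ (hconj.fromSweedlerBimod_eq_zero_iff hD t).symm
      conv_lhs => rw [← coidealOf_commutant J, mem_coidealOf]
      -- The codomain of `canonicalMap` depends on the subfield, so `hc` is used by substituting a
      -- variable.
      have key : ∀ {B B' : Subfield E} (hB : D ≤ B) (hB' : D ≤ B'), B = B' →
          (canonicalMap hB t = 0 ↔ canonicalMap hB' t = 0) := by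
        rintro B _ _ _ rfl
        rfl
      exact key _ _ hc.symm

end Sweedler

theorem mainTheorem3 {E : Type*} [DivisionRing E] (D : Subfield E) :
    ∃ R : Coideal E (Sweedler D) ≃ {C : Subfield E // D ≤ C},
      (∀ J : Coideal E (Sweedler D), ((R J : Subfield E) : Set E) =
        {e : E | e • J.proj (Sweedler.groupLike D) =
          MulOpposite.op e • J.proj (Sweedler.groupLike D)}) ∧
      (∀ C : {C : Subfield E // D ≤ C}, ((R.symm C).toAddSubgroup : AddSubgroup (Sweedler D)) =
        (Sweedler.canonicalMap C.2).ker) ∧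
      (∀ C C' : {C : Subfield E // D ≤ C},
        (∃ g : Eˣ, ((C' : Subfield E) : Set E) =
            {x : E | ∃ c ∈ (C : Subfield E), x = (g : E) * c * ((g⁻¹ : Eˣ) : E)}) ↔
          CoringsIsomorphic E (R.symm C).Quot (R.symm C').Quot) := by
  refine ⟨Sweedler.coidealEquiv D, fun J => rfl, fun C => ?_, fun C C' => ?_⟩
  · ext t
    exact Sweedler.mem_coidealOf C.2 t
  · rw [Sweedler.coringsIsomorphic_iff]
    simp only [Sweedler.coidealEquiv, Equiv.coe_fn_symm_mk, Sweedler.commutant_coidealOf]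
    constructor
    · rintro ⟨g, hg⟩
      refine ⟨g, g.ne_zero, fun e => ?_⟩
      rw [← SetLike.mem_coe (p := (C' : Subfield E)), hg]
      refine ⟨fun he => ⟨e, he, by simp⟩, ?_⟩
      rintro ⟨c, hc, h⟩
      have : e = c := by simpa using h
      exact this ▸ hc
    · rintro ⟨x, hx, h⟩
      refine ⟨Units.mk0 x hx, ?_⟩
      ext e
      constructor
      · intro he
        refine ⟨x⁻¹ * e * x, (h _).2 ?_, ?_⟩
        · simpa [mul_assoc, hx] using he
        · simp [mul_assoc, hx]
      · rintro ⟨c, hc, rfl⟩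
        simpa using (h c).1 hc
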